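/- Let $S$ be a Polish space with its Borel $\sigma$-algebra, let $\mathcal P(S)$ be the set of Borel probability measures on $S$ with the topology of weak convergence, $\mathcal M(S)$ the space of finite signed Borel measures on $S$, and $C_b(S)$ the space of bounded continuous functions $S\to\mathbb R$ with the weak topology induced by $\mathcal M(S)$, i.e. the coarsest topology for which $g\mapsto\int_S g\,d\eta$ is continuous for every $\eta\in\mathcal M(S)$. Call $\Gamma\subset C_b(S)$ admissible if (i) $\Gamma$ is convex and closed in $C_b(S)$; (ii) $g\in\Gamma$ implies $-g\in\Gamma$, and $\Gamma$ contains all constant functions; (iii) for all $\mu\neq\nu$ in $\mathcal P(S)$ there is $g\in\Gamma$ with $\int_S g\,d\mu\ne\int_S g\,d\nu$. For $\mu,\eta\in\mathcal M(S)$ and $\nu\in\mathcal P(S)$ put $$G_\Gamma(\mu\|\nu)=\sup_{g\in\Gamma}\Big\{\int_S g\,d\mu-\log\int_S e^{g}\,d\nu\Big\},\qquad W_\Gamma(\eta)=\sup_{g\in\Gamma}\int_S g\,d\eta,$$ with values in the extended reals. For $\mu,\nu\in\mathcal P(S)$ let $R(\mu\|\nu)=\int_S\log\frac{d\mu}{d\nu}\,d\mu$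 if $\mu\ll\nu$ and $R(\mu\|\nu)=\infty$ otherwise. Let $\Gamma$ be admissible. Then the following hold. 1) For all $\mu,\nu\in\mathcal P(S)$, $G_\Gamma(\mu\|\nu)\ge0$, with $G_\Gamma(\mu\|\nu)=0$ if and only if $\mu=\nu$. 2) $(\mu,\nu)\mapsto G_\Gamma(\mu\|\nu)$ is a convex and lower semicontinuous function on $\mathcal P(S)\times\mathcal P(S)$. In particular, $G_\Gamma(\mu\|\nu)$ is a convex, lower semicontinuous function of each of the variables $\mu$ and $\nu$ separately. 3) For all $\mu,\nu\in\mathcal P(S)$, $G_\Gamma(\mu\|\nu)\le R(\mu\|\nu)$ and $G_\Gamma(\mu\|\nu)\le W_\Gamma(\mu-\nu)$. -/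

import Mathlib

namespace GammaDiv

noncomputable section

open MeasureTheory BoundedContinuousFunction

/-- A probability measure regarded as an element of the space of finite signed measures. -/
def toSigned {S : Type*} [MeasurableSpace S] (μ : ProbabilityMeasure S) : SignedMeasure S :=
  (μ : Measure S).toSignedMeasure

/-- The convex combination `t μ + (1 - t) ν` of two probability measures. -/
def mix {S : Type*} [MeasurableSpace S] (t : unitInterval) (μ ν : ProbabilityMeasure S) :
    ProbabilityMeasure S :=
  ⟨ENNReal.ofReal (t : ℝ) • (μ : Measure S) + ENNReal.ofReal (1 - (t : ℝ)) • (ν : Measure S), by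
    constructor
    simp only [Measure.coe_add, Measure.coe_smul, Pi.add_apply, Pi.smul_apply, measure_univ,
      smul_eq_mul, mul_one]
    rw [← ENNReal.ofReal_add t.2.1 (sub_nonneg.2 t.2.2)]
    simp⟩

/-- The weak topology on `C_b(S)` induced by the finite signed Borel measures: the coarsest
topology for which `g ↦ ∫ g dη` is continuous for every finite signed measure `η`. -/
abbrev weakTopology (S : Type*) [TopologicalSpace S] [MeasurableSpace S] :
    TopologicalSpace (S →ᵇ ℝ) :=
  TopologicalSpace.induced (fun (g : S →ᵇ ℝ) (η : SignedMeasure S) => ∫ᵛ x, g x ∂<•η)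
    Pi.topologicalSpace

/-- Admissible classes of test functions. -/
structure IsAdmissible {S : Type*} [TopologicalSpace S] [MeasurableSpace S]
    (Γ : Set (S →ᵇ ℝ)) : Prop where
  convex : Convex ℝ Γ
  closed : @IsClosed _ (weakTopology S) Γ
  neg_mem : ∀ g ∈ Γ, -g ∈ Γ
  const_mem : ∀ c : ℝ, BoundedContinuousFunction.const S c ∈ Γ
  determining : ∀ μ ν : ProbabilityMeasure S, μ ≠ ν →
    ∃ g ∈ Γ, ∫ x, g x ∂(μ : Measure S) ≠ ∫ x, g x ∂(ν : Measure S)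

/-- The `Γ`-divergence `G_Γ(μ‖ν) = sup_{g ∈ Γ} (∫ g dμ - log ∫ e^g dν)`, for a finite signed
measure `μ` and a probability measure `ν`, with values in the extended reals. -/
def divergence {S : Type*} [TopologicalSpace S] [MeasurableSpace S] (Γ : Set (S →ᵇ ℝ))
    (μ : SignedMeasure S) (ν : ProbabilityMeasure S) : EReal :=
  ⨆ g ∈ Γ, (((∫ᵛ x, g x ∂<•μ) - Real.log (∫ x, Real.exp (g x) ∂(ν : Measure S)) : ℝ) : EReal)

/-- `W_Γ(η) = sup_{g ∈ Γ} ∫ g dη`, for a finite signed measure `η`. -/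
def wass {S : Type*} [TopologicalSpace S] [MeasurableSpace S] (Γ : Set (S →ᵇ ℝ))
    (η : SignedMeasure S) : EReal :=
  ⨆ g ∈ Γ, ((∫ᵛ x, g x ∂<•η : ℝ) : EReal)

/-- The relative entropy `R(μ‖ν)` of probability measures: `∫ log (dμ/dν) dμ` if `μ ≪ ν`
(which is `+∞` when `log (dμ/dν)` is not `μ`-integrable, its negative part being always
integrable), and `+∞` otherwise. On probability measures this is Mathlib's Kullback-Leibler
divergence. -/
def relEntropy {S : Type*} [MeasurableSpace S] (μ ν : ProbabilityMeasure S) : EReal :=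
  ((InformationTheory.klDiv (μ : Measure S) (ν : Measure S) : ENNReal) : EReal)

end

end GammaDiv

namespace GammaDiv

open MeasureTheory BoundedContinuousFunction

/-! For fixed `g`, the functional `∫ g dμ - log ∫ e^g dν` is jointly convex, because log is concave,
and weakly continuous. Convexity and lower semicontinuity survive the supremum over `Γ`. The bound
by relative entropy holds for each `g` (`dualValue_le_relEntropy`). On the diagonal it becomes
Jensen's inequality `∫ g dν ≤ log ∫ e^g dν`, which gives both `G_Γ(μ‖μ) ≤ 0` and the bound by `W_Γ`.
Testing with `g = 0` gives nonnegativity. For separation, if the divergence vanishes, then `ε = 0`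
maximises the functional along `ε • g`. Its derivative there, `∫ g dμ - ∫ g dν`, is therefore zero
for every `g ∈ Γ`, and `Γ` determines measures. -/

/-- The exponential of a bounded continuous function, as a bounded continuous function. -/
noncomputable def expBounded {S : Type*} [TopologicalSpace S] (g : S →ᵇ ℝ) : S →ᵇ ℝ :=
  BoundedContinuousFunction.ofNormedAddCommGroup (fun x => Real.exp (g x))
    (Real.continuous_exp.comp g.continuous) (Real.exp ‖g‖) fun x => by
      rw [Real.norm_eq_abs, Real.abs_exp]
      exact Real.exp_le_exp.2 ((Real.le_norm_self _).trans (g.norm_coe_le_norm x))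

/-- Specialises joint convexity to convexity in one variable with the other held fixed. -/
lemma mix_self {S : Type*} [MeasurableSpace S] (t : unitInterval) (ν : ProbabilityMeasure S) : mix t ν ν = ν := by
  apply Subtype.ext
  change ENNReal.ofReal (t : ℝ) • (ν : Measure S) + ENNReal.ofReal (1 - (t : ℝ)) • (ν : Measure S)
    = ν
  rw [← add_smul, ← ENNReal.ofReal_add t.2.1 (sub_nonneg.2 t.2.2)]
  simp

section

variable {S : Type*} [TopologicalSpace S] [MeasurableSpace S]

/-- The functional `∫ g dμ - log ∫ e^g dν` whose supremum over `g ∈ Γ` is the `Γ`-divergence. -/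
noncomputable def dualValue (g : S →ᵇ ℝ) (μ ν : ProbabilityMeasure S) : ℝ :=
  ∫ x, g x ∂(μ : Measure S) - Real.log (∫ x, Real.exp (g x) ∂(ν : Measure S))

lemma divergence_toSigned (Γ : Set (S →ᵇ ℝ)) (μ ν : ProbabilityMeasure S) :
    divergence Γ (toSigned μ) ν = ⨆ g ∈ Γ, (dualValue g μ ν : EReal) := by
  simp only [divergence, toSigned, VectorMeasure.integral_toSignedMeasure, dualValue]

lemma dualValue_le_divergence {Γ : Set (S →ᵇ ℝ)} {g : S →ᵇ ℝ} (hg : g ∈ Γ)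
    (μ ν : ProbabilityMeasure S) :
    (dualValue g μ ν : EReal) ≤ divergence Γ (toSigned μ) ν := by
  rw [divergence_toSigned]
  exact le_iSup₂ (f := fun (g : S →ᵇ ℝ) (_ : g ∈ Γ) => (dualValue g μ ν : EReal)) g hg

lemma IsAdmissible.divergence_nonneg {Γ : Set (S →ᵇ ℝ)} (hΓ : IsAdmissible Γ)
    (μ ν : ProbabilityMeasure S) : 0 ≤ divergence Γ (toSigned μ) ν := by
  simpa [dualValue] using dualValue_le_divergence (hΓ.const_mem 0) μ ν

/-- Weights `(1 ± ε) / 2` on `g` and `-g` stay in `Γ` by convexity and symmetry, so `Γ` contains a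
segment through `0` in the direction `g`. -/
lemma IsAdmissible.smul_mem {Γ : Set (S →ᵇ ℝ)} (hΓ : IsAdmissible Γ) {g : S →ᵇ ℝ} (hg : g ∈ Γ)
    {ε : ℝ} (hε : |ε| ≤ 1) : ε • g ∈ Γ := by
  obtain ⟨h₁, h₂⟩ := abs_le.1 hε
  have h := hΓ.convex hg (hΓ.neg_mem g hg) (a := (1 + ε) / 2) (b := (1 - ε) / 2)
    (by linarith) (by linarith) (by ring)
  convert h using 1
  module

variable [OpensMeasurableSpace S]

lemma integrable_exp (g : S →ᵇ ℝ) (ν : Measure S) [IsFiniteMeasure ν] :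
    Integrable (fun x => Real.exp (g x)) ν :=
  (expBounded g).integrable ν

lemma integral_mix (t : unitInterval) (μ ν : ProbabilityMeasure S) (g : S →ᵇ ℝ) :
    ∫ x, g x ∂(mix t μ ν : Measure S) =
      t * ∫ x, g x ∂(μ : Measure S) + (1 - t) * ∫ x, g x ∂(ν : Measure S) := by
  change ∫ x, g x ∂(ENNReal.ofReal (t : ℝ) • (μ : Measure S) +
    ENNReal.ofReal (1 - (t : ℝ)) • (ν : Measure S)) = _
  rw [integral_add_measure ((g.integrable _).smul_measure ENNReal.ofReal_ne_top)
    ((g.integrable _).smul_measure ENNReal.ofReal_ne_top), integral_smul_measure,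
    integral_smul_measure, ENNReal.toReal_ofReal t.2.1,
    ENNReal.toReal_ofReal (sub_nonneg.2 t.2.2), smul_eq_mul, smul_eq_mul]

lemma dualValue_mix_le (g : S →ᵇ ℝ) (t : unitInterval) (μ₁ μ₂ ν₁ ν₂ : ProbabilityMeasure S) :
    dualValue g (mix t μ₁ μ₂) (mix t ν₁ ν₂) ≤
      t * dualValue g μ₁ ν₁ + (1 - t) * dualValue g μ₂ ν₂ := by
  have hexp : ∫ x, Real.exp (g x) ∂(mix t ν₁ ν₂ : Measure S) =
      t * ∫ x, Real.exp (g x) ∂(ν₁ : Measure S) +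
        (1 - t) * ∫ x, Real.exp (g x) ∂(ν₂ : Measure S) :=
    integral_mix t ν₁ ν₂ (expBounded g)
  have hlog := strictConcaveOn_log_Ioi.concaveOn.2
    (integral_exp_pos (integrable_exp g (ν₁ : Measure S)))
    (integral_exp_pos (integrable_exp g (ν₂ : Measure S)))
    t.2.1 (sub_nonneg.2 t.2.2) (add_sub_cancel _ _)
  simp only [smul_eq_mul] at hlog
  simp only [dualValue, integral_mix, hexp]
  linarith

lemma continuous_dualValue (g : S →ᵇ ℝ) :
    Continuous fun p : ProbabilityMeasure S × ProbabilityMeasure S => dualValue g p.1 p.2 := by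
  have h : Continuous fun ν : ProbabilityMeasure S => ∫ x, Real.exp (g x) ∂(ν : Measure S) :=
    ProbabilityMeasure.continuous_integral_boundedContinuousFunction (expBounded g)
  refine ((ProbabilityMeasure.continuous_integral_boundedContinuousFunction g).comp
    continuous_fst).sub ((h.comp continuous_snd).log fun p => ?_)
  exact (integral_exp_pos (integrable_exp g (p.2 : Measure S))).ne'

/-- The easy half of the Donsker–Varadhan variational formula. -/
lemma dualValue_le_relEntropy (g : S →ᵇ ℝ) (μ ν : ProbabilityMeasure S) :
    (dualValue g μ ν : EReal) ≤ relEntropy μ ν := by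
  by_cases h : InformationTheory.klDiv (μ : Measure S) (ν : Measure S) = ⊤
  · simp [relEntropy, h]
  obtain ⟨hac, hint⟩ := InformationTheory.klDiv_ne_top_iff.1 h
  have hexp := integrable_exp g (ν : Measure S)
  have hprob : IsProbabilityMeasure ((ν : Measure S).tilted g) :=
    isProbabilityMeasure_tilted hexp
  -- Gibbs' inequality for `μ` against the tilted measure `e^g ν / ∫ e^g dν`: tilting changes the
  -- log-likelihood ratio by `-g + log ∫ e^g dν`.
  have hgibbs := InformationTheory.integral_llr_add_sub_measure_univ_nonneg
    (hac.trans (absolutelyContinuous_tilted hexp))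
    (integrable_llr_tilted_right hac (g.integrable _) hint hexp)
  rw [integral_llr_tilted_right hac (g.integrable _) hexp hint] at hgibbs
  have hkl := InformationTheory.toReal_klDiv_of_measure_eq hac (by simp)
  rw [relEntropy, ← EReal.coe_toReal (by simpa using h) (EReal.coe_ennreal_ne_bot _),
    EReal.coe_le_coe_iff, EReal.toReal_coe_ennreal, hkl, dualValue]
  simp only [probReal_univ] at hgibbs
  linarith

lemma dualValue_self_nonpos (g : S →ᵇ ℝ) (ν : ProbabilityMeasure S) : dualValue g ν ν ≤ 0 := by
  have h := dualValue_le_relEntropy g ν ν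
  rw [relEntropy, InformationTheory.klDiv_self, EReal.coe_ennreal_zero] at h
  exact EReal.coe_nonpos.1 h

/-- The logarithmic term is the cumulant generating function of `g` under `ν`, finite everywhere
since `g` is bounded, with derivative at `0` equal to the mean. -/
lemma hasDerivAt_dualValue_smul (g : S →ᵇ ℝ) (μ ν : ProbabilityMeasure S) :
    HasDerivAt (fun ε : ℝ => dualValue (ε • g) μ ν)
      (∫ x, g x ∂(μ : Measure S) - ∫ x, g x ∂(ν : Measure S)) 0 := by
  have huniv : ProbabilityTheory.integrableExpSet g (ν : Measure S) = Set.univ :=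
    Set.eq_univ_of_forall fun t => integrable_exp (t • g) (ν : Measure S)
  have hmem : (0 : ℝ) ∈ interior (ProbabilityTheory.integrableExpSet g (ν : Measure S)) := by
    simp [huniv]
  have hcgf := (ProbabilityTheory.analyticAt_cgf hmem).differentiableAt.hasDerivAt
  rw [ProbabilityTheory.deriv_cgf_zero hmem, probReal_univ, div_one] at hcgf
  have hlin := (hasDerivAt_id (0 : ℝ)).mul_const (∫ x, g x ∂(μ : Measure S))
  rw [one_mul] at hlin
  refine (hlin.sub hcgf).congr_of_eventuallyEq (Filter.Eventually.of_forall fun ε => ?_)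
  simp [dualValue, ProbabilityTheory.cgf, ProbabilityTheory.mgf, integral_const_mul]

lemma IsAdmissible.divergence_eq_zero_iff {Γ : Set (S →ᵇ ℝ)} (hΓ : IsAdmissible Γ)
    (μ ν : ProbabilityMeasure S) : divergence Γ (toSigned μ) ν = 0 ↔ μ = ν := by
  constructor
  · intro h
    by_contra hne
    obtain ⟨g, hg, hint⟩ := hΓ.determining μ ν hne
    -- The value at `ε = 0` is `0`, and for `|ε| < 1` the value is at most the divergence, which is
    -- `0`.
    refine hint (sub_eq_zero.1 (IsLocalMax.hasDerivAt_eq_zero ?_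
      (hasDerivAt_dualValue_smul g μ ν)))
    filter_upwards [Metric.ball_mem_nhds (0 : ℝ) one_pos] with ε hε
    have hε' : |ε| ≤ 1 := by simpa using (Metric.mem_ball.1 hε).le
    have hle := dualValue_le_divergence (hΓ.smul_mem hg hε') μ ν
    rw [h] at hle
    simpa [dualValue] using EReal.coe_nonpos.1 hle
  · rintro rfl
    refine le_antisymm ?_ (hΓ.divergence_nonneg μ μ)
    rw [divergence_toSigned]
    exact iSup₂_le fun g _ => EReal.coe_nonpos.2 (dualValue_self_nonpos g μ)

lemma divergence_mix_le (Γ : Set (S →ᵇ ℝ)) (t : unitInterval)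
    (μ₁ μ₂ ν₁ ν₂ : ProbabilityMeasure S) :
    divergence Γ (toSigned (mix t μ₁ μ₂)) (mix t ν₁ ν₂) ≤
      ((t : ℝ) : EReal) * divergence Γ (toSigned μ₁) ν₁ +
        ((1 - (t : ℝ) : ℝ) : EReal) * divergence Γ (toSigned μ₂) ν₂ := by
  rw [divergence_toSigned]
  refine iSup₂_le fun g hg => ?_
  calc (dualValue g (mix t μ₁ μ₂) (mix t ν₁ ν₂) : EReal)
      ≤ ((t * dualValue g μ₁ ν₁ + (1 - t) * dualValue g μ₂ ν₂ : ℝ) : EReal) :=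
        EReal.coe_le_coe_iff.2 (dualValue_mix_le g t μ₁ μ₂ ν₁ ν₂)
    _ = ((t : ℝ) : EReal) * dualValue g μ₁ ν₁ + ((1 - t : ℝ) : EReal) * dualValue g μ₂ ν₂ := by
        rw [EReal.coe_add, EReal.coe_mul, EReal.coe_mul]
    -- Nonnegative weights keep multiplication monotone in `EReal`, even when a divergence is `⊤`.
    _ ≤ _ := add_le_add
        (mul_le_mul_of_nonneg_left (dualValue_le_divergence hg μ₁ ν₁)
          (EReal.coe_nonneg.2 t.2.1))
        (mul_le_mul_of_nonneg_left (dualValue_le_divergence hg μ₂ ν₂)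
          (EReal.coe_nonneg.2 (sub_nonneg.2 t.2.2)))

lemma lowerSemicontinuous_divergence (Γ : Set (S →ᵇ ℝ)) :
    LowerSemicontinuous fun p : ProbabilityMeasure S × ProbabilityMeasure S =>
      divergence Γ (toSigned p.1) p.2 := by
  simp only [divergence_toSigned]
  exact lowerSemicontinuous_biSup fun g _ =>
    (continuous_coe_real_ereal.comp (continuous_dualValue g)).lowerSemicontinuous

lemma lowerSemicontinuous_divergence_left (Γ : Set (S →ᵇ ℝ)) (ν : ProbabilityMeasure S) :
    LowerSemicontinuous fun μ : ProbabilityMeasure S => divergence Γ (toSigned μ) ν :=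
  (lowerSemicontinuous_divergence Γ).comp
    (g := fun μ : ProbabilityMeasure S => (μ, ν)) (by fun_prop)

lemma lowerSemicontinuous_divergence_right (Γ : Set (S →ᵇ ℝ)) (μ : ProbabilityMeasure S) :
    LowerSemicontinuous fun ν : ProbabilityMeasure S => divergence Γ (toSigned μ) ν :=
  (lowerSemicontinuous_divergence Γ).comp
    (g := fun ν : ProbabilityMeasure S => (μ, ν)) (by fun_prop)

lemma divergence_le_relEntropy (Γ : Set (S →ᵇ ℝ)) (μ ν : ProbabilityMeasure S) :
    divergence Γ (toSigned μ) ν ≤ relEntropy μ ν := by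
  rw [divergence_toSigned]
  exact iSup₂_le fun g _ => dualValue_le_relEntropy g μ ν

lemma integral_toSigned_sub (g : S →ᵇ ℝ) (μ ν : ProbabilityMeasure S) :
    ∫ᵛ x, g x ∂<•(toSigned μ - toSigned ν) =
      ∫ x, g x ∂(μ : Measure S) - ∫ x, g x ∂(ν : Measure S) := by
  have h (ρ : ProbabilityMeasure S) : (toSigned ρ).Integrable g := by
    simpa [toSigned, VectorMeasure.Integrable] using g.integrable (ρ : Measure S)
  rw [VectorMeasure.integral_sub_vectorMeasure (h μ) (h ν)]
  simp only [toSigned, VectorMeasure.integral_toSignedMeasure]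

/-- The comparison is made with the same `g` on both sides: the gap is `log ∫ e^g dν - ∫ g dν`,
nonnegative by Jensen. -/
lemma divergence_le_wass (Γ : Set (S →ᵇ ℝ)) (μ ν : ProbabilityMeasure S) :
    divergence Γ (toSigned μ) ν ≤ wass Γ (toSigned μ - toSigned ν) := by
  rw [divergence_toSigned, wass]
  refine iSup₂_mono fun g _ => EReal.coe_le_coe_iff.2 ?_
  have h := dualValue_self_nonpos g ν
  rw [integral_toSigned_sub]
  unfold dualValue at h ⊢
  linarith

end

end GammaDiv

theorem mainTheorem2 {S : Type*} [TopologicalSpace S] [PolishSpace S] [MeasurableSpace S]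
    [BorelSpace S] (Γ : Set (BoundedContinuousFunction S ℝ)) (hΓ : GammaDiv.IsAdmissible Γ) :
    -- nonnegativity and separation
    (∀ μ ν : MeasureTheory.ProbabilityMeasure S,
      0 ≤ GammaDiv.divergence Γ (GammaDiv.toSigned μ) ν ∧
      (GammaDiv.divergence Γ (GammaDiv.toSigned μ) ν = 0 ↔ μ = ν)) ∧
    -- joint convexity
    (∀ (t : unitInterval) (μ₁ μ₂ ν₁ ν₂ : MeasureTheory.ProbabilityMeasure S),
      GammaDiv.divergence Γ (GammaDiv.toSigned (GammaDiv.mix t μ₁ μ₂)) (GammaDiv.mix t ν₁ ν₂) ≤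
        ((t : ℝ) : EReal) * GammaDiv.divergence Γ (GammaDiv.toSigned μ₁) ν₁ +
          ((1 - (t : ℝ) : ℝ) : EReal) * GammaDiv.divergence Γ (GammaDiv.toSigned μ₂) ν₂) ∧
    -- joint lower semicontinuity, for weak convergence of probability measures
    LowerSemicontinuous
      (fun p : MeasureTheory.ProbabilityMeasure S × MeasureTheory.ProbabilityMeasure S =>
        GammaDiv.divergence Γ (GammaDiv.toSigned p.1) p.2) ∧
    -- convexity and lower semicontinuity in the first variable
    (∀ ν : MeasureTheory.ProbabilityMeasure S,
      (∀ (t : unitInterval) (μ₁ μ₂ : MeasureTheory.ProbabilityMeasure S),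
        GammaDiv.divergence Γ (GammaDiv.toSigned (GammaDiv.mix t μ₁ μ₂)) ν ≤
          ((t : ℝ) : EReal) * GammaDiv.divergence Γ (GammaDiv.toSigned μ₁) ν +
            ((1 - (t : ℝ) : ℝ) : EReal) * GammaDiv.divergence Γ (GammaDiv.toSigned μ₂) ν) ∧
      LowerSemicontinuous (fun μ : MeasureTheory.ProbabilityMeasure S =>
        GammaDiv.divergence Γ (GammaDiv.toSigned μ) ν)) ∧
    -- convexity and lower semicontinuity in the second variable
    (∀ μ : MeasureTheory.ProbabilityMeasure S,
      (∀ (t : unitInterval) (ν₁ ν₂ : MeasureTheory.ProbabilityMeasure S),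
        GammaDiv.divergence Γ (GammaDiv.toSigned μ) (GammaDiv.mix t ν₁ ν₂) ≤
          ((t : ℝ) : EReal) * GammaDiv.divergence Γ (GammaDiv.toSigned μ) ν₁ +
            ((1 - (t : ℝ) : ℝ) : EReal) * GammaDiv.divergence Γ (GammaDiv.toSigned μ) ν₂) ∧
      LowerSemicontinuous (fun ν : MeasureTheory.ProbabilityMeasure S =>
        GammaDiv.divergence Γ (GammaDiv.toSigned μ) ν)) ∧
    -- comparison with relative entropy and with the Wasserstein-type functional
    (∀ μ ν : MeasureTheory.ProbabilityMeasure S,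
      GammaDiv.divergence Γ (GammaDiv.toSigned μ) ν ≤ GammaDiv.relEntropy μ ν ∧
      GammaDiv.divergence Γ (GammaDiv.toSigned μ) ν ≤
        GammaDiv.wass Γ (GammaDiv.toSigned μ - GammaDiv.toSigned ν)) := by
  refine ⟨fun μ ν => ⟨hΓ.divergence_nonneg μ ν, hΓ.divergence_eq_zero_iff μ ν⟩,
    GammaDiv.divergence_mix_le Γ, GammaDiv.lowerSemicontinuous_divergence Γ,
    fun ν => ⟨fun t μ₁ μ₂ => ?_, ?_⟩, fun μ => ⟨fun t ν₁ ν₂ => ?_, ?_⟩,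
    fun μ ν => ⟨GammaDiv.divergence_le_relEntropy Γ μ ν, GammaDiv.divergence_le_wass Γ μ ν⟩⟩
  · simpa only [GammaDiv.mix_self] using GammaDiv.divergence_mix_le Γ t μ₁ μ₂ ν ν
  · exact GammaDiv.lowerSemicontinuous_divergence_left Γ ν
  · simpa only [GammaDiv.mix_self] using GammaDiv.divergence_mix_le Γ t μ μ ν₁ ν₂
  · exact GammaDiv.lowerSemicontinuous_divergence_right Γ μ
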